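/- Let $\mathcal H_1,\mathcal H_2$ be finite-dimensional complex Hilbert spaces; operators are written as matrices in fixed orthonormal bases, so that $\otimes$ is the Kronecker product. Write $\mathrm{PSD}(\mathcal H)$ for the positive semidefinite operators on $\mathcal H$ and $\mathcal D(\mathcal H)$ for the density operators (positive semidefinite, trace one). For a set $\mathcal C$ of Hermitian operators on $\mathcal H$ let $$\mathcal C^\circ_+ := \{X\in \mathrm{PSD}(\mathcal H) : \operatorname{tr}[XY]\le 1 \text{ for all } Y\in\mathcal C\}.$$ For $\rho\in\mathcal D(\mathcal H)$ and $\sigma\in\mathrm{PSD}(\mathcal H)$ the measured relative entropy is $$D_{\mathbb M}(\rho\|\sigma) := \sup_{(\mathcal X,M)} \ \sum_{x\in\mathcal X} \operatorname{tr}[M_x\rho]\,\log_2\frac{\operatorname{tr}[M_x\rho]}{\operatorname{tr}[M_x\sigma]} \ \in(-\infty,+\infty],$$ where the supremum runs over finite sets $\mathcal X$ and all positive operator valued measures $M=(M_x)_{x\in\mathcal X}$, $M_x\ge 0$, $\sum_{x} M_x=I$; a term with $\operatorname{tr}[M_x\rho]=0$ is $0$, and the sum is $+\infty$ if $\operatorname{tr}[M_x\sigma]=0<\operatorname{tr}[M_x\rho]$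 for some $x$. For sets $\mathcal A\subseteq\mathcal D(\mathcal H)$ and $\mathcal B\subseteq\mathrm{PSD}(\mathcal H)$ put $$D_{\mathbb M}(\mathcal A\|\mathcal B):=\inf_{\rho\in\mathcal A,\ \sigma\in\mathcal B} D_{\mathbb M}(\rho\|\sigma),$$ with $\inf\emptyset=+\infty$. Let $\mathcal A_1\subseteq\mathcal D(\mathcal H_1)$, $\mathcal A_2\subseteq\mathcal D(\mathcal H_2)$, $\mathcal A_{12}\subseteq\mathcal D(\mathcal H_1\otimes\mathcal H_2)$ and $\mathcal B_1\subseteq\mathrm{PSD}(\mathcal H_1)$, $\mathcal B_2\subseteq\mathrm{PSD}(\mathcal H_2)$, $\mathcal B_{12}\subseteq\mathrm{PSD}(\mathcal H_1\otimes\mathcal H_2)$ be convex and compact. Assume that $X_1\otimes X_2\in(\mathcal A_{12})^\circ_+$ for all $X_1\in(\mathcal A_1)^\circ_+$, $X_2\in(\mathcal A_2)^\circ_+$, and that $X_1\otimes X_2\in(\mathcal B_{12})^\circ_+$ for all $X_1\in(\mathcal B_1)^\circ_+$, $X_2\in(\mathcal B_2)^\circ_+$. Then $$D_{\mathbb M}(\mathcal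 A_{12}\|\mathcal B_{12})\ \ge\ D_{\mathbb M}(\mathcal A_1\|\mathcal B_1)+D_{\mathbb M}(\mathcal A_2\|\mathcal B_2).$$ -/

import Mathlib

open scoped Kronecker ComplexOrder

noncomputable section

namespace MeasuredDivergence

/-- The set of density matrices on `ℂ^n`: positive semidefinite matrices of trace one. -/
def densityMatrices (n : Type*) [Fintype n] : Set (Matrix n n ℂ) :=
  {ρ | ρ.PosSemidef ∧ ρ.trace = 1}

/-- The cone of positive semidefinite matrices on `ℂ^n`. -/
def psdMatrices (n : Type*) [Fintype n] : Set (Matrix n n ℂ) :=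
  {σ | σ.PosSemidef}

/-- The polar set `C° = {X : tr[X Y] ≤ 1 for all Y ∈ C}` among Hermitian matrices.
For Hermitian `X` and `Y` the number `tr[X Y]` is real, so `re` loses nothing. -/
def polar {n : Type*} [Fintype n] (C : Set (Matrix n n ℂ)) : Set (Matrix n n ℂ) :=
  {X | X.IsHermitian ∧ ∀ Y ∈ C, (X * Y).trace.re ≤ 1}

/-- The positive polar `C°₊`: the polar set intersected with the positive semidefinite cone. -/
def polarPSD {n : Type*} [Fintype n] (C : Set (Matrix n n ℂ)) : Set (Matrix n n ℂ) :=
  polar C ∩ psdMatrices n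

/-- A positive operator valued measure on `ℂ^n` with finite outcome set `X`. -/
structure POVM (X n : Type*) [Fintype X] [Fintype n] [DecidableEq n] where
  /-- the effect belonging to each outcome -/
  effect : X → Matrix n n ℂ
  posSemidef : ∀ x, (effect x).PosSemidef
  sum_eq_one : ∑ x, effect x = 1

/-- The outcome weights `P_{ρ,M}(x) = tr[M_x ρ]`; for positive semidefinite `ρ` the trace is a
nonnegative real number. -/
def POVM.outcome {X n : Type*} [Fintype X] [Fintype n] [DecidableEq n]
    (M : POVM X n) (ρ : Matrix n n ℂ) (x : X) : ℝ :=
  (M.effect x * ρ).trace.re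

open Classical in
/-- The Kullback–Leibler divergence `∑ P(x) log₂ (P(x) / Q(x))` of finite measures on a finite set,
equal to `+∞` unless `P` is absolutely continuous with respect to `Q`. The second argument need not
have total mass one and there is no correction term `Q(X) - P(X)`, which is why Mathlib's
`InformationTheory.klDiv` is not used. A term with `P(x) = 0` contributes `0`. -/
def klDivergence {X : Type*} [Fintype X] (P Q : X → ℝ) : EReal :=
  if ∀ x, Q x = 0 → P x = 0 then ((∑ x, P x * Real.logb 2 (P x / Q x) : ℝ) : EReal) else ⊤

/-- The measured relative entropy: the supremum over all measurements with finitely many outcomes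
(labelled by `Fin k`) of the Kullback–Leibler divergence of the outcome distributions. -/
def measuredRelEntropy {n : Type*} [Fintype n] [DecidableEq n] (ρ σ : Matrix n n ℂ) : EReal :=
  ⨆ (k : ℕ) (M : POVM (Fin k) n), klDivergence (M.outcome ρ) (M.outcome σ)

/-- The measured relative entropy between two sets,
`D_M(A‖B) = inf {D_M(ρ‖σ) : ρ ∈ A, σ ∈ B}`. -/
def measuredRelEntropySets {n : Type*} [Fintype n] [DecidableEq n]
    (A B : Set (Matrix n n ℂ)) : EReal :=
  ⨅ (ρ ∈ A) (σ ∈ B), measuredRelEntropy ρ σ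

end MeasuredDivergence

end

/-! Since `log x ≤ x - 1`, the divergence times `log 2` is the supremum of `tr[L ρ] - tr[ω σ] + 1`
over test pairs `L = ∑ g(x) M_x`, `ω = ∑ exp(g(x)) M_x`. These pairs form a convex set, so minimax
(`exists_testPair_of_lt_sets`) gives one pair valid for all states at once. Rescaling `ω` into the
positive polar of `B` turns this into `tr[L ρ] ≥ c log 2` on `A` (`exists_povm_of_lt`).

Given such pairs for both factors, the product measurement with `g = f₁ + f₂` has `L = L₁ ⊗ 1 + 1 ⊗
L₂` and `ω = ω₁ ⊗ ω₂`. The polar assumption on `B₁₂` gives `tr[ω σ] ≤ 1`; the one on `A₁₂` transfers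
each bound on `Lᵢ` (`le_tracePairing_map_of_polarPSD`). The two bounds add. -/

noncomputable section

namespace MeasuredDivergence

/-! ### Minimax for bilinear forms. -/

section Minimax

variable {E F : Type*} [TopologicalSpace E] [AddCommGroup E] [Module ℝ E]
  [IsTopologicalAddGroup E] [ContinuousSMul ℝ E]
  [TopologicalSpace F] [AddCommGroup F] [Module ℝ F]
  [IsTopologicalAddGroup F] [ContinuousSMul ℝ F]

/-- Minimax for a continuous bilinear form on the product of a compact convex set and a convex set:
a strict lower bound on `inf sup` is attained by a single `y`. -/
theorem exists_forall_lt_of_forall_exists_lt {X : Set E} {Y : Set F} (f : E →ₗ[ℝ] F →ₗ[ℝ] ℝ)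
    (hf : Continuous fun p : E × F => f p.1 p.2)
    (neX : X.Nonempty) (cX : Convex ℝ X) (kX : IsCompact X) (cY : Convex ℝ Y)
    {t : ℝ} (h : ∀ x ∈ X, ∃ y ∈ Y, t < f x y) : ∃ y ∈ Y, ∀ x ∈ X, t < f x y := by
  have hfX : ∀ y, Continuous fun x => f x y := fun y =>
    hf.comp (Continuous.prodMk continuous_id continuous_const)
  have hfY : ∀ x, Continuous fun y => f x y := fun x =>
    hf.comp (Continuous.prodMk continuous_const continuous_id)
  -- Compactness leaves finitely many `y` to consider, so no infimum over `Y` has to be bounded.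
  obtain ⟨s, hs⟩ := kX.elim_finite_subcover (fun y : Y => {x | t < f x y})
    (fun y => isOpen_lt continuous_const (hfX y)) (by
      intro x hx
      obtain ⟨y, hy, hxy⟩ := h x hx
      exact Set.mem_iUnion.2 ⟨⟨y, hy⟩, hxy⟩)
  refine Sion.exists_lt_iInf_of_lt_iInf_of_finite neX kX
    (fun y _ => (hfX y).lowerSemicontinuous.lowerSemicontinuousOn X)
    (fun y _ => ((f.flip y).convexOn cX).quasiconvexOn) cY
    (fun x _ => (hfY x).upperSemicontinuous.upperSemicontinuousOn Y)
    (fun x _ => ((f x).concaveOn cY).quasiconcaveOn) cX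
    (s := (fun y : Y => (y : F)) '' (s : Set Y)) (s.finite_toSet.image _) (by simp) ?_
  intro x hx
  obtain ⟨y, hys, hxy⟩ := Set.mem_iUnion₂.1 (hs hx)
  exact ⟨y, ⟨y, hys, rfl⟩, hxy⟩

end Minimax

/-! ### Variational formula for the classical divergence. -/

section Classical

variable {X : Type*} [Fintype X]

/-- This is `log x ≤ x - 1` at `x = (q / p) exp g`; for positive `p`, `q` it is tight at `g = log (p
/ q)`. -/
theorem mul_sub_mul_exp_le {p q : ℝ} (g : ℝ) (hp : 0 ≤ p) (hq : 0 ≤ q) (h : q = 0 → p = 0) :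
    p * g - q * Real.exp g + p ≤ p * Real.log (p / q) := by
  rcases hp.eq_or_lt with rfl | hp
  · have := mul_nonneg hq (Real.exp_pos g).le
    simp; linarith
  have hq : 0 < q := hq.lt_of_ne fun h0 => hp.ne' (h h0.symm)
  have hx : 0 < q / p * Real.exp g := by positivity
  have h1 := mul_le_mul_of_nonneg_left (Real.log_le_sub_one_of_pos hx) hp.le
  rw [Real.log_mul (by positivity) (by positivity), Real.log_exp,
    ← inv_div p q, Real.log_inv] at h1
  have h2 : p * ((p / q)⁻¹ * Real.exp g - 1) = q * Real.exp g - p := by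
    field_simp
  linarith

theorem sum_mul_logb (P Q : X → ℝ) :
    ∑ x, P x * Real.logb 2 (P x / Q x) = (∑ x, P x * Real.log (P x / Q x)) / Real.log 2 := by
  simp only [Real.logb, Finset.sum_div, mul_div_assoc]

/-- The variational lower bound on the Kullback–Leibler divergence (in bits). -/
theorem le_klDivergence {P Q : X → ℝ} (hP : ∀ x, 0 ≤ P x) (hQ : ∀ x, 0 ≤ Q x)
    (hP1 : ∑ x, P x = 1) (g : X → ℝ) :
    (((∑ x, g x * P x - ∑ x, Real.exp (g x) * Q x + 1) / Real.log 2 : ℝ) : EReal)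
      ≤ klDivergence P Q := by
  unfold klDivergence
  split_ifs with h
  · rw [EReal.coe_le_coe_iff, sum_mul_logb]
    refine div_le_div_of_nonneg_right ?_ (Real.log_nonneg one_le_two)
    rw [← hP1, ← Finset.sum_sub_distrib, ← Finset.sum_add_distrib]
    refine Finset.sum_le_sum fun x _ => ?_
    linarith [mul_sub_mul_exp_le (g x) (hP x) (hQ x) (h x)]
  · exact le_top

/-- The variational lower bounds approximate the Kullback–Leibler divergence. -/
theorem exists_lt_of_lt_klDivergence {P Q : X → ℝ} (hP : ∀ x, 0 ≤ P x) (hQ : ∀ x, 0 ≤ Q x)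
    (hP1 : ∑ x, P x = 1) {c : ℝ} (hc : (c : EReal) < klDivergence P Q) :
    ∃ g : X → ℝ,
      c * Real.log 2 < ∑ x, g x * P x - ∑ x, Real.exp (g x) * Q x + 1 := by
  classical
  have hlog : 0 < Real.log 2 := Real.log_pos one_lt_two
  unfold klDivergence at hc
  split_ifs at hc with h
  · rw [EReal.coe_lt_coe_iff, sum_mul_logb, lt_div_iff₀ hlog] at hc
    have hlim : Filter.Tendsto
        (fun T : ℝ => ∑ x, P x * Real.log (P x / Q x) - Real.exp T * ∑ x, Q x)
        Filter.atBot (nhds (∑ x, P x * Real.log (P x / Q x) - 0 * ∑ x, Q x)) :=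
      tendsto_const_nhds.sub (Real.tendsto_exp_atBot.mul_const _)
    rw [zero_mul, sub_zero] at hlim
    obtain ⟨T, hT⟩ := (hlim.eventually (lt_mem_nhds hc)).exists
    -- The optimal weight is `log (P x / Q x)`. Where `P x = 0` this would be `-∞`; a very negative
    -- `T` replaces it, at total cost at most `exp T * ∑ Q`.
    refine ⟨fun x => if P x = 0 then T else Real.log (P x / Q x), hT.trans_le ?_⟩
    rw [← hP1, Finset.mul_sum, ← Finset.sum_sub_distrib, ← Finset.sum_sub_distrib,
      ← Finset.sum_add_distrib]
    refine Finset.sum_le_sum fun x _ => ?_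
    have hTQ := mul_nonneg (Real.exp_pos T).le (hQ x)
    by_cases hx : P x = 0
    · simp [hx]
    · have hq : Q x ≠ 0 := fun h0 => hx (h x h0)
      have hpos : 0 < P x / Q x :=
        div_pos ((hP x).lt_of_ne' hx) ((hQ x).lt_of_ne' hq)
      simp only [hx, if_false, Real.exp_log hpos, div_mul_cancel₀ _ hq]
      linarith
  · push Not at h
    obtain ⟨x, hq, hp⟩ := h
    have hp : 0 < P x := (hP x).lt_of_ne' hp
    -- Weight at `x` costs nothing because `Q x = 0`; this value leaves a surplus of exactly `1`.
    refine ⟨Pi.single x ((c * Real.log 2 + ∑ y, Q y) / P x), ?_⟩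
    have h1 : ∑ y, (Pi.single x ((c * Real.log 2 + ∑ y, Q y) / P x) : X → ℝ) y * P y
        = c * Real.log 2 + ∑ y, Q y := by
      rw [Finset.sum_eq_single x]
      · simp [hp.ne']
      · intro y _ hy; simp [hy]
      · simp
    have h2 : ∑ y, Real.exp ((Pi.single x ((c * Real.log 2 + ∑ y, Q y) / P x) : X → ℝ) y) * Q y
        = ∑ y, Q y := by
      refine Finset.sum_congr rfl fun y _ => ?_
      by_cases hy : y = x
      · subst hy; simp [hq]
      · simp [hy]
    rw [h1, h2]; linarith

end Classical

/-! ### The trace pairing and positive polars. -/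

section Pairing

variable {n : Type*} [Fintype n]

/-- The real bilinear form `(X, Y) ↦ Re tr[X Y]`. -/
def tracePairing : Matrix n n ℂ →ₗ[ℝ] Matrix n n ℂ →ₗ[ℝ] ℝ :=
  LinearMap.mk₂ ℝ (fun X Y => (X * Y).trace.re)
    (by intros; simp [add_mul]) (by intros; simp)
    (by intros; simp [mul_add]) (by intros; simp)

theorem tracePairing_apply (X Y : Matrix n n ℂ) : tracePairing X Y = (X * Y).trace.re := rfl

theorem continuous_tracePairing {α : Type*} [TopologicalSpace α] {f g : α → Matrix n n ℂ}
    (hf : Continuous f) (hg : Continuous g) : Continuous fun a => tracePairing (f a) (g a) := by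
  simp only [tracePairing_apply]
  exact Complex.continuous_re.comp (hf.matrix_mul hg).matrix_trace

open scoped MatrixOrder Matrix.Norms.L2Operator in
theorem tracePairing_nonneg {X Y : Matrix n n ℂ} (hX : X.PosSemidef) (hY : Y.PosSemidef) :
    0 ≤ tracePairing X Y := by
  classical
  obtain ⟨a, rfl⟩ := CStarAlgebra.nonneg_iff_eq_star_mul_self.mp hX.nonneg
  rw [tracePairing_apply, mul_assoc, Matrix.trace_mul_comm]
  exact (Complex.nonneg_iff.1 (hY.mul_mul_conjTranspose_same a).trace_nonneg).1

theorem tracePairing_one_left [DecidableEq n] (Y : Matrix n n ℂ) :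
    tracePairing 1 Y = Y.trace.re := by simp [tracePairing_apply]

theorem mem_polarPSD_iff {C : Set (Matrix n n ℂ)} {X : Matrix n n ℂ} :
    X ∈ polarPSD C ↔ X.PosSemidef ∧ ∀ Y ∈ C, tracePairing X Y ≤ 1 :=
  ⟨fun h => ⟨h.2, h.1.2⟩, fun h => ⟨⟨h.1.isHermitian, h.2⟩, h.1⟩⟩

theorem one_mem_polarPSD [DecidableEq n] {A : Set (Matrix n n ℂ)} (hA : A ⊆ densityMatrices n) :
    1 ∈ polarPSD A := by
  refine mem_polarPSD_iff.2 ⟨Matrix.PosSemidef.one, fun Y hY => ?_⟩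
  rw [tracePairing_one_left, (hA hY).2, Complex.one_re]

omit [Fintype n] in
theorem posSemidef_real_smul {X : Matrix n n ℂ} (hX : X.PosSemidef) {r : ℝ} (hr : 0 ≤ r) :
    (r • X).PosSemidef := by
  rw [← Complex.coe_smul]
  exact hX.smul (by exact_mod_cast hr)

end Pairing

/-! ### Measurements and test pairs. -/

section Test

variable {X Y n : Type*} [Fintype X] [Fintype Y] [Fintype n] [DecidableEq n]

namespace POVM

variable (M : POVM X n)

/-- The combination `∑ f(x) M_x` of the effects of a measurement. -/
def combine (f : X → ℝ) : Matrix n n ℂ := ∑ x, f x • M.effect x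

theorem posSemidef_combine {f : X → ℝ} (hf : ∀ x, 0 ≤ f x) : (M.combine f).PosSemidef :=
  Matrix.posSemidef_sum _ fun x _ => posSemidef_real_smul (M.posSemidef x) (hf x)

theorem combine_const (c : ℝ) : M.combine (fun _ => c) = c • 1 := by
  rw [combine, ← Finset.smul_sum, M.sum_eq_one]

theorem combine_add (f g : X → ℝ) :
    M.combine (fun x => f x + g x) = M.combine f + M.combine g := by
  simp only [combine, add_smul, Finset.sum_add_distrib]

theorem combine_sub (f g : X → ℝ) :
    M.combine (fun x => f x - g x) = M.combine f - M.combine g := by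
  simp only [combine, sub_smul, Finset.sum_sub_distrib]

theorem combine_mul (c : ℝ) (f : X → ℝ) :
    M.combine (fun x => c * f x) = c • M.combine f := by
  simp only [combine, mul_smul, Finset.smul_sum]

theorem tracePairing_combine (f : X → ℝ) (ρ : Matrix n n ℂ) :
    tracePairing (M.combine f) ρ = ∑ x, f x * M.outcome ρ x := by
  simp only [combine, map_sum, map_smul, LinearMap.sum_apply, LinearMap.smul_apply, smul_eq_mul]
  rfl

theorem outcome_nonneg {ρ : Matrix n n ℂ} (hρ : ρ.PosSemidef) (x : X) : 0 ≤ M.outcome ρ x :=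
  tracePairing_nonneg (M.posSemidef x) hρ

theorem sum_outcome {ρ : Matrix n n ℂ} (hρ : ρ ∈ densityMatrices n) :
    ∑ x, M.outcome ρ x = 1 := by
  have := M.tracePairing_combine (fun _ => 1) ρ
  rw [combine_const, one_smul, tracePairing_one_left, hρ.2] at this
  simpa using this.symm

/-- Relabelling the outcomes of a measurement. -/
def relabel (e : Y ≃ X) : POVM Y n where
  effect y := M.effect (e y)
  posSemidef y := M.posSemidef (e y)
  sum_eq_one := by rw [e.sum_comp M.effect, M.sum_eq_one]

theorem combine_relabel (e : Y ≃ X) (f : X → ℝ) :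
    (M.relabel e).combine (f ∘ e) = M.combine f :=
  e.sum_comp fun x => f x • M.effect x

/-- The measurement that performs `M` with probability `a` and `N` with probability `b`. -/
def mix (N : POVM Y n) {a b : ℝ} (ha : 0 ≤ a) (hb : 0 ≤ b) (hab : a + b = 1) :
    POVM (X ⊕ Y) n where
  effect := Sum.elim (fun x => a • M.effect x) (fun y => b • N.effect y)
  posSemidef := by
    rintro (x | y)
    · exact posSemidef_real_smul (M.posSemidef x) ha
    · exact posSemidef_real_smul (N.posSemidef y) hb
  sum_eq_one := by
    simp only [Fintype.sum_sum_type, Sum.elim_inl, Sum.elim_inr, ← Finset.smul_sum,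
      M.sum_eq_one, N.sum_eq_one, ← add_smul, hab, one_smul]

theorem combine_mix (N : POVM Y n) {a b : ℝ} (ha : 0 ≤ a) (hb : 0 ≤ b) (hab : a + b = 1)
    (f : X ⊕ Y → ℝ) :
    (M.mix N ha hb hab).combine f
      = a • M.combine (fun x => f (.inl x)) + b • N.combine (fun y => f (.inr y)) := by
  simp only [combine, mix, Fintype.sum_sum_type, Sum.elim_inl, Sum.elim_inr, Finset.smul_sum,
    smul_comm a, smul_comm b]

variable {m : Type*} [Fintype m] [DecidableEq m]

omit [Fintype n] [DecidableEq n] [Fintype m] [DecidableEq m] in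
theorem sum_kronecker_sum (a : X → Matrix n n ℂ) (b : Y → Matrix m m ℂ) :
    ∑ p : X × Y, a p.1 ⊗ₖ b p.2 = (∑ x, a x) ⊗ₖ (∑ y, b y) := by
  ext i j
  simp only [Matrix.sum_apply, Matrix.kroneckerMap_apply, Fintype.sum_prod_type,
    Finset.sum_mul_sum]

/-- The product measurement. -/
def kronecker (N : POVM Y m) : POVM (X × Y) (n × m) where
  effect p := M.effect p.1 ⊗ₖ N.effect p.2
  posSemidef p := (M.posSemidef p.1).kronecker (N.posSemidef p.2)
  sum_eq_one := by
    rw [sum_kronecker_sum, M.sum_eq_one, N.sum_eq_one, Matrix.one_kronecker_one]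

theorem combine_kronecker (N : POVM Y m) (f : X → ℝ) (g : Y → ℝ) :
    (M.kronecker N).combine (fun p => f p.1 * g p.2) = M.combine f ⊗ₖ N.combine g := by
  simp only [combine, kronecker]
  rw [← sum_kronecker_sum]
  refine Finset.sum_congr rfl fun p _ => ?_
  rw [Matrix.smul_kronecker, Matrix.kronecker_smul, smul_smul]

end POVM

variable (n) in
/-- The pairs `(∑ g(x) M_x, ∑ exp(g(x)) M_x)` that test the measured relative entropy from below. -/
def testPairs : Set (Matrix n n ℂ × Matrix n n ℂ) :=
  {p | ∃ (k : ℕ) (M : POVM (Fin k) n) (g : Fin k → ℝ),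
    p = (M.combine g, M.combine fun x => Real.exp (g x))}

/-- Needed because mixtures and products of measurements have outcomes in sum and product types. -/
theorem POVM.mem_testPairs (M : POVM X n) (g : X → ℝ) :
    (M.combine g, M.combine fun x => Real.exp (g x)) ∈ testPairs n := by
  let e := (Fintype.equivFin X).symm
  refine ⟨_, M.relabel e, g ∘ e, ?_⟩
  rw [M.combine_relabel]
  exact congrArg _ (M.combine_relabel e fun x => Real.exp (g x)).symm

/-- Randomizing between two measurements, with the chosen one recorded in the outcome, keeps both
weight functions, so `L` and `ω` mix with the same coefficients. -/
theorem convex_testPairs : Convex ℝ (testPairs n) := by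
  rintro _ ⟨k, M, g, rfl⟩ _ ⟨l, N, h, rfl⟩ a b ha hb hab
  have := (M.mix N ha hb hab).mem_testPairs (Sum.elim g h)
  rw [POVM.combine_mix, POVM.combine_mix] at this
  exact this

theorem le_measuredRelEntropy {ρ σ : Matrix n n ℂ} (hρ : ρ ∈ densityMatrices n)
    (hσ : σ.PosSemidef) {p : Matrix n n ℂ × Matrix n n ℂ} (hp : p ∈ testPairs n) :
    (((tracePairing p.1 ρ - tracePairing p.2 σ + 1) / Real.log 2 : ℝ) : EReal)
      ≤ measuredRelEntropy ρ σ := by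
  obtain ⟨k, M, g, rfl⟩ := hp
  refine le_trans ?_ (le_iSup₂ (f := fun k (M : POVM (Fin k) n) =>
    klDivergence (M.outcome ρ) (M.outcome σ)) k M)
  simp only [M.tracePairing_combine]
  exact le_klDivergence (M.outcome_nonneg hρ.1) (M.outcome_nonneg hσ) (M.sum_outcome hρ) g

theorem exists_testPair_of_lt {ρ σ : Matrix n n ℂ} (hρ : ρ ∈ densityMatrices n)
    (hσ : σ.PosSemidef) {c : ℝ} (hc : (c : EReal) < measuredRelEntropy ρ σ) :
    ∃ p ∈ testPairs n, c * Real.log 2 - 1 < tracePairing p.1 ρ - tracePairing p.2 σ := by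
  obtain ⟨k, hk⟩ := lt_iSup_iff.1 hc
  obtain ⟨M, hM⟩ := lt_iSup_iff.1 hk
  obtain ⟨g, hg⟩ := exists_lt_of_lt_klDivergence (M.outcome_nonneg hρ.1) (M.outcome_nonneg hσ)
    (M.sum_outcome hρ) hM
  refine ⟨_, M.mem_testPairs g, ?_⟩
  simp only [M.tracePairing_combine]
  linarith

/-- Minimax for the measured relative entropy between compact convex sets. -/
theorem exists_testPair_of_lt_sets {A B : Set (Matrix n n ℂ)}
    (hA : A ⊆ densityMatrices n) (cA : Convex ℝ A) (kA : IsCompact A) (neA : A.Nonempty)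
    (hB : B ⊆ psdMatrices n) (cB : Convex ℝ B) (kB : IsCompact B) (neB : B.Nonempty)
    {c : ℝ} (hc : (c : EReal) < measuredRelEntropySets A B) :
    ∃ p ∈ testPairs n, ∀ ρ ∈ A, ∀ σ ∈ B,
      c * Real.log 2 - 1 < tracePairing p.1 ρ - tracePairing p.2 σ := by
  let Φ : (Matrix n n ℂ × Matrix n n ℂ) →ₗ[ℝ] (Matrix n n ℂ × Matrix n n ℂ) →ₗ[ℝ] ℝ :=
    tracePairing.flip.compl₁₂ (LinearMap.fst ℝ _ _) (LinearMap.fst ℝ _ _) -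
      tracePairing.flip.compl₁₂ (LinearMap.snd ℝ _ _) (LinearMap.snd ℝ _ _)
  have hΦ : ∀ q p : Matrix n n ℂ × Matrix n n ℂ, Φ q p = tracePairing p.1 q.1 - tracePairing p.2 q.2 := fun _ _ => rfl
  have hcont : Continuous fun q :
      (Matrix n n ℂ × Matrix n n ℂ) × (Matrix n n ℂ × Matrix n n ℂ) => Φ q.1 q.2 := by
    simp only [hΦ]
    have h1 : Continuous fun q :
        (Matrix n n ℂ × Matrix n n ℂ) × (Matrix n n ℂ × Matrix n n ℂ) =>
          tracePairing q.2.1 q.1.1 :=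
      continuous_tracePairing (by fun_prop) (by fun_prop)
    have h2 : Continuous fun q :
        (Matrix n n ℂ × Matrix n n ℂ) × (Matrix n n ℂ × Matrix n n ℂ) =>
          tracePairing q.2.2 q.1.2 :=
      continuous_tracePairing (by fun_prop) (by fun_prop)
    exact h1.sub h2
  obtain ⟨p, hp, h⟩ := exists_forall_lt_of_forall_exists_lt (t := c * Real.log 2 - 1)
    Φ hcont (neA.prod neB) (cA.prod cB) (kA.prod kB) convex_testPairs (by
      rintro ⟨ρ, σ⟩ ⟨hρ, hσ⟩
      refine exists_testPair_of_lt (hA hρ) (hB hσ) (hc.trans_le ?_)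
      exact iInf₂_le_of_le ρ hρ (iInf₂_le σ hσ))
  exact ⟨p, hp, fun ρ hρ σ hσ => h (ρ, σ) ⟨hρ, hσ⟩⟩

/-- Normalized form: the second member of the test pair lies in the positive polar of `B`. -/
theorem exists_povm_of_lt {A B : Set (Matrix n n ℂ)}
    (hA : A ⊆ densityMatrices n) (cA : Convex ℝ A) (kA : IsCompact A)
    (hB : B ⊆ psdMatrices n) (cB : Convex ℝ B) (kB : IsCompact B)
    {c : ℝ} (hc : (c : EReal) < measuredRelEntropySets A B) :
    ∃ (k : ℕ) (M : POVM (Fin k) n) (g : Fin k → ℝ),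
      M.combine (fun x => Real.exp (g x)) ∈ polarPSD B ∧
      ∀ ρ ∈ A, c * Real.log 2 ≤ tracePairing (M.combine g) ρ := by
  have hpsd : ∀ {k : ℕ} (M : POVM (Fin k) n) (g : Fin k → ℝ),
      (M.combine fun x => Real.exp (g x)).PosSemidef := fun M g =>
    M.posSemidef_combine fun x => (Real.exp_pos _).le
  let M₀ : POVM (Fin 1) n := ⟨fun _ => 1, fun _ => Matrix.PosSemidef.one, by simp⟩
  rcases B.eq_empty_or_nonempty with rfl | neB
  -- With `B` empty the polar only demands positivity, so a constant weight suffices.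
  · refine ⟨1, M₀, fun _ => c * Real.log 2,
      mem_polarPSD_iff.2 ⟨hpsd _ _, by simp⟩, fun ρ hρ => ?_⟩
    rw [M₀.combine_const, map_smul, LinearMap.smul_apply, tracePairing_one_left, (hA hρ).2]
    simp
  have hcont : ∀ Z : Matrix n n ℂ, Continuous fun σ => tracePairing Z σ := fun Z =>
    continuous_tracePairing continuous_const continuous_id
  -- Shifting the weights by `-log s` divides `ω` by `s`.
  have key : ∀ {k : ℕ} (M : POVM (Fin k) n) (g : Fin k → ℝ) (s : ℝ), 0 < s →
      (∀ σ ∈ B, tracePairing (M.combine fun x => Real.exp (g x)) σ ≤ s) →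
      M.combine (fun x => Real.exp (-Real.log s + g x)) ∈ polarPSD B := by
    intro k M g s hs h
    refine mem_polarPSD_iff.2 ⟨hpsd _ _, fun σ hσ => ?_⟩
    simp only [Real.exp_add, Real.exp_neg, Real.exp_log hs]
    rw [M.combine_mul, map_smul, LinearMap.smul_apply, smul_eq_mul, inv_mul_le_iff₀ hs, mul_one]
    exact h σ hσ
  rcases A.eq_empty_or_nonempty with rfl | neA
  · obtain ⟨σ₀, hσ₀, hmax⟩ := kB.exists_isMaxOn neB
      (hcont (M₀.combine fun _ => Real.exp 0)).continuousOn
    refine ⟨1, M₀, _, key M₀ (fun _ => 0) _ (lt_max_of_lt_right one_pos) fun σ hσ =>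
      (hmax hσ).trans (le_max_left _ 1), by simp⟩
  -- The gap `c' - c` keeps the scale `s` positive even when `tr[ω σ]` vanishes on all of `B`.
  obtain ⟨c', hcc', hc'⟩ := EReal.lt_iff_exists_real_btwn.1 hc
  obtain ⟨_, ⟨k, M, g, rfl⟩, h⟩ := exists_testPair_of_lt_sets hA cA kA neA hB cB kB neB hc'
  obtain ⟨σ₀, hσ₀, hmax⟩ := kB.exists_isMaxOn neB
    (hcont (M.combine fun x => Real.exp (g x))).continuousOn
  set ω := M.combine fun x => Real.exp (g x)
  have hs₀ : 0 ≤ tracePairing ω σ₀ := tracePairing_nonneg (hpsd M g) (hB hσ₀)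
  have hδ : 0 < (c' - c) * Real.log 2 :=
    mul_pos (sub_pos.2 (EReal.coe_lt_coe_iff.1 hcc')) (Real.log_pos one_lt_two)
  set s := tracePairing ω σ₀ + (c' - c) * Real.log 2 with hs_def
  have hs : 0 < s := by positivity
  refine ⟨k, M, _, key M g s hs fun σ hσ => (hmax hσ).trans (by linarith), fun ρ hρ => ?_⟩
  rw [M.combine_add (fun _ => -Real.log s) g, M.combine_const, map_add, LinearMap.add_apply,
    map_smul, LinearMap.smul_apply, tracePairing_one_left, (hA hρ).2, Complex.one_re,
    smul_eq_mul, mul_one]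
  -- The shift loses `log s ≤ s - 1`, which the bound at the maximizer `σ₀` and the gap pay for.
  have h1 := Real.log_le_sub_one_of_pos hs
  have h2 := h ρ hρ σ₀ hσ₀
  dsimp only at h2
  linarith

end Test

/-! ### Transfer of lower bounds through polars. -/

section Marginal

variable {n m : Type*} [Fintype n] [DecidableEq n] [Fintype m]

/-- If the positive polar of `A` is mapped into the positive polar of `A'` by a linear map `φ` that
is normalized on `A'`, then lower bounds of observables on `A` transfer to `A'`. -/
theorem le_tracePairing_map_of_polarPSD {X : Type*} [Fintype X]
    {A : Set (Matrix n n ℂ)} {A' : Set (Matrix m m ℂ)}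
    (hA : A ⊆ densityMatrices n) (φ : Matrix n n ℂ →ₗ[ℝ] Matrix m m ℂ)
    (hφ : ∀ Z ∈ polarPSD A, φ Z ∈ polarPSD A')
    (hφ1 : ∀ ρ ∈ A', tracePairing (φ 1) ρ = 1) (M : POVM X n) (g : X → ℝ) {c : ℝ}
    (hc : ∀ ρ ∈ A, c ≤ tracePairing (M.combine g) ρ) {ρ : Matrix m m ℂ} (hρ : ρ ∈ A') :
    c ≤ tracePairing (φ (M.combine g)) ρ := by
  -- `L ≥ c` on `A` says that `(t - L) / (t - c)` pairs to at most `1`; `t ≥ g` makes it positive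
  -- semidefinite, hence a member of the polar.
  obtain ⟨t, ht⟩ : ∃ t : ℝ, c < t ∧ ∀ x, g x ≤ t := by
    obtain ⟨t, ht⟩ := (Set.finite_range g).bddAbove
    exact ⟨max t (c + 1), by simp, fun x => (ht ⟨x, rfl⟩).trans (le_max_left _ _)⟩
  have htc : 0 < t - c := sub_pos.2 ht.1
  have hmem : (t - c)⁻¹ • (t • 1 - M.combine g) ∈ polarPSD A := by
    refine mem_polarPSD_iff.2 ⟨posSemidef_real_smul ?_ (inv_pos.2 htc).le, fun τ hτ => ?_⟩
    · rw [← M.combine_const, ← M.combine_sub]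
      exact M.posSemidef_combine fun x => sub_nonneg.2 (ht.2 x)
    · simp only [map_smul, map_sub, LinearMap.smul_apply, LinearMap.sub_apply, smul_eq_mul,
        tracePairing_one_left, (hA hτ).2, Complex.one_re]
      rw [inv_mul_le_iff₀ htc]
      linarith [hc τ hτ]
  have h := (mem_polarPSD_iff.1 (hφ _ hmem)).2 ρ hρ
  simp only [map_smul, map_sub, LinearMap.smul_apply, LinearMap.sub_apply, smul_eq_mul,
    hφ1 ρ hρ] at h
  rw [inv_mul_le_iff₀ htc] at h
  linarith

end Marginal

end MeasuredDivergence

end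

/-! ### Superadditivity. -/

open MeasuredDivergence in
theorem mainTheorem4
    {n₁ n₂ : Type*} [Fintype n₁] [DecidableEq n₁] [Fintype n₂] [DecidableEq n₂]
    (A₁ B₁ : Set (Matrix n₁ n₁ ℂ)) (A₂ B₂ : Set (Matrix n₂ n₂ ℂ))
    (A₁₂ B₁₂ : Set (Matrix (n₁ × n₂) (n₁ × n₂) ℂ))
    (hA₁ : A₁ ⊆ densityMatrices n₁) (hA₁conv : Convex ℝ A₁) (hA₁comp : IsCompact A₁)
    (hA₂ : A₂ ⊆ densityMatrices n₂) (hA₂conv : Convex ℝ A₂) (hA₂comp : IsCompact A₂)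
    (hA₁₂ : A₁₂ ⊆ densityMatrices (n₁ × n₂)) (hA₁₂conv : Convex ℝ A₁₂) (hA₁₂comp : IsCompact A₁₂)
    (hB₁ : B₁ ⊆ psdMatrices n₁) (hB₁conv : Convex ℝ B₁) (hB₁comp : IsCompact B₁)
    (hB₂ : B₂ ⊆ psdMatrices n₂) (hB₂conv : Convex ℝ B₂) (hB₂comp : IsCompact B₂)
    (hB₁₂ : B₁₂ ⊆ psdMatrices (n₁ × n₂)) (hB₁₂conv : Convex ℝ B₁₂) (hB₁₂comp : IsCompact B₁₂)
    (hApolar : Set.image2 (fun X₁ X₂ => X₁ ⊗ₖ X₂) (polarPSD A₁) (polarPSD A₂) ⊆ polarPSD A₁₂)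
    (hBpolar : Set.image2 (fun X₁ X₂ => X₁ ⊗ₖ X₂) (polarPSD B₁) (polarPSD B₂) ⊆ polarPSD B₁₂) :
    measuredRelEntropySets A₁₂ B₁₂ ≥
      measuredRelEntropySets A₁ B₁ + measuredRelEntropySets A₂ B₂ := by
  refine EReal.add_le_of_forall_lt fun a ha b hb => ?_
  induction a with
  | bot => simp
  | top => exact absurd ha (not_lt.2 le_top)
  | coe a =>
  induction b with
  | bot => simp
  | top => exact absurd hb (not_lt.2 le_top)
  | coe b =>
  obtain ⟨k, M, f, hωM, hM⟩ := exists_povm_of_lt hA₁ hA₁conv hA₁comp hB₁ hB₁conv hB₁comp ha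
  obtain ⟨l, N, g, hωN, hN⟩ := exists_povm_of_lt hA₂ hA₂conv hA₂comp hB₂ hB₂conv hB₂comp hb
  refine le_iInf₂ fun ρ hρ => le_iInf₂ fun σ hσ => ?_
  have h1 : ∀ τ ∈ A₁₂, tracePairing ((1 : Matrix n₁ n₁ ℂ) ⊗ₖ (1 : Matrix n₂ n₂ ℂ)) τ = 1 :=
    fun τ hτ => by
      rw [Matrix.one_kronecker_one, tracePairing_one_left, (hA₁₂ hτ).2, Complex.one_re]
  -- The identity lies in the positive polar of any set of density matrices, so it can fill the
  -- other tensor factor.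
  have hL₁ : a * Real.log 2 ≤ tracePairing (M.combine f ⊗ₖ (1 : Matrix n₂ n₂ ℂ)) ρ :=
    le_tracePairing_map_of_polarPSD hA₁ ((Matrix.kroneckerBilinear (R := ℝ)).flip 1)
      (fun Z hZ => hApolar ⟨Z, hZ, 1, one_mem_polarPSD hA₂, rfl⟩)
      (A' := A₁₂) h1 M f hM hρ
  have hL₂ : b * Real.log 2 ≤ tracePairing ((1 : Matrix n₁ n₁ ℂ) ⊗ₖ N.combine g) ρ :=
    le_tracePairing_map_of_polarPSD hA₂ (Matrix.kroneckerBilinear (R := ℝ) 1)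
      (fun Z hZ => hApolar ⟨1, one_mem_polarPSD hA₁, Z, hZ, rfl⟩)
      (A' := A₁₂) h1 N g hN hρ
  have hω := (mem_polarPSD_iff.1 (hBpolar ⟨_, hωM, _, hωN, rfl⟩)).2 σ hσ
  have hp := (M.kronecker N).mem_testPairs fun p => f p.1 + g p.2
  have hL : (M.kronecker N).combine (fun p => f p.1 + g p.2)
      = M.combine f ⊗ₖ (1 : Matrix n₂ n₂ ℂ) + (1 : Matrix n₁ n₁ ℂ) ⊗ₖ N.combine g := by
    have h₁ := M.combine_kronecker N f fun _ => 1
    have h₂ := M.combine_kronecker N (fun _ => 1) g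
    simp only [POVM.combine_const, one_smul, mul_one, one_mul] at h₁ h₂
    rw [POVM.combine_add _ (fun p : Fin k × Fin l => f p.1) (fun p => g p.2), h₁, h₂]
  simp only [Real.exp_add] at hp
  rw [hL, M.combine_kronecker N (fun x => Real.exp (f x)) (fun y => Real.exp (g y))] at hp
  refine le_trans ?_ (le_measuredRelEntropy (hA₁₂ hρ) (hB₁₂ hσ) hp)
  rw [← EReal.coe_add, EReal.coe_le_coe_iff, le_div_iff₀ (Real.log_pos one_lt_two)]
  simp only [map_add, LinearMap.add_apply]
  linarith
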